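/- Let $G = A *_C B$ be the amalgamated free product of two groups $A$ and $B$ along a common subgroup $C$ (that is, along injective homomorphisms $C \to A$ and $C \to B$), where no finiteness or finite generation is assumed. Suppose that $|C\backslash A/C| \ge 3$ and $|B/C| \ge 2$. Let $H^2_b(G;\mathbb{R})$ be the second bounded cohomology of $G$, i.e. the second cohomology of the complex of functions $f : G^k \to \mathbb{R}$ with bounded range, with boundary $$\delta f(g_0,\dots,g_k) = f(g_1,\dots,g_k) + \sum_{i=1}^{k} (-1)^i f(g_0,\dots,g_{i-1}g_i,\dots,g_k) + (-1)^{k+1} f(g_0,\dots,g_{k-1}).$$ Then the dimension of $H^2_b(G;\mathbb{R})$ as a real vector space is at least the cardinality of the continuum; and if $G$ is countable, the dimension is exactly the cardinality of the continuum. -/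

import Mathlib

universe u v

namespace AmalgHb

noncomputable section

/-! ### Bounded cohomology of a group with trivial real coefficients -/

section BoundedCohomology

variable (G : Type u) [Group G]

/-- The real vector space `C^k_b(G; ℝ)` of functions `G^k → ℝ` with bounded range. -/
def boundedCochain (k : ℕ) : Submodule ℝ ((Fin k → G) → ℝ) where
  carrier := {f | ∃ K : ℝ, ∀ x, |f x| ≤ K}
  zero_mem' := ⟨0, fun x => by simp⟩
  add_mem' := by
    rintro f g ⟨K, hK⟩ ⟨L, hL⟩
    exact ⟨K + L, fun x => (abs_add_le _ _).trans (add_le_add (hK x) (hL x))⟩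
  smul_mem' := by
    rintro c f ⟨K, hK⟩
    refine ⟨|c| * K, fun x => ?_⟩
    rw [Pi.smul_apply, smul_eq_mul, abs_mul]
    exact mul_le_mul_of_nonneg_left (hK x) (abs_nonneg c)

/-- The inhomogeneous boundary map on all (not necessarily bounded) cochains:
`δ f (g₀, …, g_k) = f (g₁, …, g_k) + ∑_{i=1}^{k} (-1)^i f (g₀, …, g_{i-1} g_i, …, g_k)
  + (-1)^{k+1} f (g₀, …, g_{k-1})`.
In the sum below `i = j + 1`; for `j < k`, `Fin.contractNth j` multiplies the entries `j` and
`j + 1`, and for `j = k` it deletes the last entry. -/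
def coboundary (k : ℕ) : ((Fin k → G) → ℝ) →ₗ[ℝ] ((Fin (k + 1) → G) → ℝ) where
  toFun f g := f (fun i => g i.succ) +
    ∑ j : Fin (k + 1), (-1 : ℝ) ^ ((j : ℕ) + 1) * f (Fin.contractNth j (· * ·) g)
  map_add' f g := by
    ext x
    simp only [Pi.add_apply, mul_add, Finset.sum_add_distrib]
    ring
  map_smul' c f := by
    ext x
    simp only [Pi.smul_apply, smul_eq_mul, RingHom.id_apply, mul_add, Finset.mul_sum]
    congr 1
    exact Finset.sum_congr rfl fun j _ => by ring

theorem coboundary_mem (k : ℕ) (f : (Fin k → G) → ℝ) (hf : f ∈ boundedCochain G k) :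
    coboundary G k f ∈ boundedCochain G (k + 1) := by
  obtain ⟨K, hK⟩ := hf
  refine ⟨K + ∑ _j : Fin (k + 1), K, fun x => ?_⟩
  refine (abs_add_le _ _).trans (add_le_add (hK _) ?_)
  refine (Finset.abs_sum_le_sum_abs _ _).trans (Finset.sum_le_sum fun j _ => ?_)
  rw [abs_mul, abs_pow, abs_neg, abs_one, one_pow, one_mul]
  exact hK _

/-- The bounded `k`-cocycles: bounded cochains with vanishing boundary. -/
def boundedCocycles (k : ℕ) : Submodule ℝ ((Fin k → G) → ℝ) :=
  boundedCochain G k ⊓ LinearMap.ker (coboundary G k)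

/-- The bounded `k`-coboundaries: boundaries of *bounded* `(k-1)`-cochains. -/
def boundedCoboundaries : (k : ℕ) → Submodule ℝ ((Fin k → G) → ℝ)
  | 0 => ⊥
  | k + 1 => (boundedCochain G k).map (coboundary G k)

/-- The bounded cohomology `H^k_b(G; ℝ)`, cocycles modulo coboundaries, a real vector space. -/
abbrev BoundedCohomology (k : ℕ) : Type u :=
  boundedCocycles G k ⧸ (boundedCoboundaries G k).submoduleOf (boundedCocycles G k)

end BoundedCohomology

/-! ### Amalgamated free products of two groups -/

section Amalgam

/-- The two-member family `A, B`. -/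
def Factor (A B : Type u) : Bool → Type u
  | false => A
  | true => B

instance factorGroup (A B : Type u) [Group A] [Group B] : (i : Bool) → Group (Factor A B i)
  | false => inferInstanceAs (Group A)
  | true => inferInstanceAs (Group B)

variable {A B : Type u} {C : Type v} [Group A] [Group B] [Group C]

/-- The two maps from the amalgamated group to the factors. -/
def factorMap (f : C →* A) (g : C →* B) : (i : Bool) → C →* Factor A B i
  | false => f
  | true => g

/-- The amalgamated free product `A *_C B` along `f : C → A` and `g : C → B`
(intended for injective `f` and `g`). -/
abbrev AmalgamatedProduct (f : C →* A) (g : C →* B) : Type (max u v) :=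
  Monoid.PushoutI (factorMap f g)

end Amalgam

end

end AmalgHb

/-! The lower bound comes from embedding the bounded real sequences into `H^2_b` by means of
counting quasimorphisms. Colour the nontrivial double cosets of `C` in `A` with two colours, both
used, so that inversion either fixes or swaps them (`exists_doubleCoset_label`). Reading off the
colours of the `A`-syllables of a reduced word, and ignoring `B`-syllables, gives each element a
binary list. The list is well defined because two reduced words for one element differ only by
elements of `C` moved between syllables. In a product, inverse segments cancel and at most one
letter changes at the junction (`cancels_labelList`).

A bounded weight `f` on gap lengths gives a functional `scan` on binary lists. It is additive under
concatenation up to bounded error, so its antisymmetrization is a quasimorphism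
(`Cancels.abs_antiScan_le`), whose coboundary is a bounded 2-cocycle depending linearly on `f`. If
the class vanishes, the quasimorphism is within bounded distance of a homomorphism to `ℝ`. A
homomorphism cannot tell a product of elements from the same product in reverse order, whereas on
powers of a word with cyclic gaps `0, n, 1` the quasimorphism distinguishes the two orders by at
least `k * |f n|`. Hence `f n = 0` (`eq_zero_of_abs_sub_le`). Geometric sequences show that the
bounded sequences have dimension at least the continuum; for countable groups the upper bound counts
cochains. -/

namespace AmalgHb

open Monoid

/-! ### Reduced words in amalgamated products -/

section ReducedWords

variable {ι : Type*} {G : ι → Type*} {H : Type*} [∀ i, Group (G i)] [Group H]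

/-- The element of the amalgamated product represented by a list of syllables. -/
def wordProd (φ : ∀ i, H →* G i) (w : List (Σ i, G i)) : PushoutI φ :=
  (w.map fun s => PushoutI.of (φ := φ) s.1 s.2).prod

/-- A list of syllables is reduced if adjacent syllables lie in different factors and no
syllable lies in the amalgamated subgroup. -/
def IsReduced (φ : ∀ i, H →* G i) (w : List (Σ i, G i)) : Prop :=
  (w.map Sigma.fst).IsChain (· ≠ ·) ∧ ∀ s ∈ w, s.2 ∉ (φ s.1).range

/-- The formal inverse of a list of syllables. -/
def wordInv (w : List (Σ i, G i)) : List (Σ i, G i) :=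
  (w.map fun s => ⟨s.1, s.2⁻¹⟩).reverse

variable {φ : ∀ i, H →* G i}

@[simp] theorem wordProd_nil : wordProd φ [] = 1 := rfl

@[simp] theorem wordProd_cons (s : Σ i, G i) (w : List (Σ i, G i)) :
    wordProd φ (s :: w) = PushoutI.of s.1 s.2 * wordProd φ w := by
  simp [wordProd]

@[simp] theorem wordProd_append (w w' : List (Σ i, G i)) :
    wordProd φ (w ++ w') = wordProd φ w * wordProd φ w' := by
  simp [wordProd]

theorem wordProd_wordInv (w : List (Σ i, G i)) : wordProd φ (wordInv w) = (wordProd φ w)⁻¹ := by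
  induction w with
  | nil => simp [wordInv]
  | cons s w ih =>
    have : wordInv (s :: w) = wordInv w ++ [⟨s.1, s.2⁻¹⟩] := by simp [wordInv]
    rw [this]
    simp [ih]

theorem IsReduced.wordInv {w : List (Σ i, G i)} (hw : IsReduced φ w) :
    IsReduced φ (wordInv w) := by
  refine ⟨?_, ?_⟩
  · have : (AmalgHb.wordInv w).map Sigma.fst = (w.map Sigma.fst).reverse := by
      simp [AmalgHb.wordInv, Function.comp_def]
    rw [this, List.isChain_reverse]
    exact hw.1.imp fun _ _ h => h.symm
  · intro s hs
    simp only [AmalgHb.wordInv, List.mem_reverse, List.mem_map] at hs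
    obtain ⟨t, ht, rfl⟩ := hs
    simpa using hw.2 t ht

theorem IsReduced.eq_nil (hφ : ∀ i, Function.Injective (φ i)) {w : List (Σ i, G i)}
    (hw : IsReduced φ w) (h : wordProd φ w ∈ (PushoutI.base φ).range) : w = [] := by
  let W : CoprodI.Word G := ⟨w, fun l hl h1 => hw.2 l hl (h1 ▸ one_mem _), by
    simpa [List.isChain_map] using hw.1⟩
  have hW : PushoutI.Reduced φ W := hw.2
  have : W = .empty := hW.eq_empty_of_mem_range hφ (by
    have : PushoutI.ofCoprodI W.prod = wordProd φ w := by
      simp [CoprodI.Word.prod, wordProd, W, map_list_prod, Function.comp_def]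
    rwa [this])
  exact congrArg CoprodI.Word.toList this

/-- A labelling of the syllables by lists of at most one letter, depending only on the double
coset of the amalgamated subgroup, and compatible with inversion. -/
structure Labelling (φ : ∀ i, H →* G i) where
  label : (Σ i, G i) → List Bool
  flip : Bool → Bool
  flip_flip : ∀ b, flip (flip b) = b
  length_le : ∀ s, (label s).length ≤ 1
  base_mul : ∀ i c x, label ⟨i, φ i c * x⟩ = label ⟨i, x⟩
  mul_base : ∀ i c x, label ⟨i, x * φ i c⟩ = label ⟨i, x⟩
  inv : ∀ i x, x ∉ (φ i).range → label ⟨i, x⁻¹⟩ = (label ⟨i, x⟩).map flip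

/-- The reversed list, with each letter flipped. -/
def flipReverse (flip : Bool → Bool) (L : List Bool) : List Bool := (L.map flip).reverse

@[simp] theorem flipReverse_nil (flip : Bool → Bool) : flipReverse flip [] = [] := rfl

@[simp] theorem flipReverse_append (flip : Bool → Bool) (L L' : List Bool) :
    flipReverse flip (L ++ L') = flipReverse flip L' ++ flipReverse flip L := by
  simp [flipReverse]

theorem flipReverse_flipReverse {flip : Bool → Bool} (h : ∀ b, flip (flip b) = b)
    (L : List Bool) : flipReverse flip (flipReverse flip L) = L := by
  simp [flipReverse, Function.comp_def, h]

/-- The lists `L₁`, `L₂`, `L₃` are related as the label lists of two elements and of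
their product: a final segment of `L₁` cancels with an initial segment of `L₂`, and at most
one letter changes at the junction. -/
def Cancels (flip : Bool → Bool) (L₁ L₂ L₃ : List Bool) : Prop :=
  ∃ U M₁ X M₂ V M : List Bool, M₁.length ≤ 1 ∧ M₂.length ≤ 1 ∧ M.length ≤ 1 ∧
    L₁ = U ++ M₁ ++ X ∧ L₂ = flipReverse flip X ++ M₂ ++ V ∧ L₃ = U ++ M ++ V

namespace Labelling

variable (lab : Labelling φ)

/-- The list of labels of a list of syllables. -/
def labels (w : List (Σ i, G i)) : List Bool := w.flatMap lab.label

@[simp] theorem labels_nil : lab.labels [] = [] := rfl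

@[simp] theorem labels_cons (s : Σ i, G i) (w : List (Σ i, G i)) :
    lab.labels (s :: w) = lab.label s ++ lab.labels w := by simp [labels]

@[simp] theorem labels_append (w w' : List (Σ i, G i)) :
    lab.labels (w ++ w') = lab.labels w ++ lab.labels w' := by simp [labels]

theorem flipReverse_label (s : Σ i, G i) :
    flipReverse lab.flip (lab.label s) = (lab.label s).map lab.flip := by
  have := lab.length_le s
  unfold flipReverse
  match lab.label s, this with
  | [], _ => rfl
  | [_], _ => rfl

theorem labels_wordInv {w : List (Σ i, G i)} (hw : ∀ s ∈ w, s.2 ∉ (φ s.1).range) :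
    lab.labels (wordInv w) = flipReverse lab.flip (lab.labels w) := by
  induction w with
  | nil => rfl
  | cons s w ih =>
    have : wordInv (s :: w) = wordInv w ++ [⟨s.1, s.2⁻¹⟩] := by simp [wordInv]
    rw [this, labels_append, ih fun t ht => hw t (List.mem_cons_of_mem _ ht), labels_cons,
      labels_cons, flipReverse_append, flipReverse_label, labels_nil, List.append_nil,
      lab.inv _ _ (hw s List.mem_cons_self)]

/-- Cancellation proceeds from the junction outwards. A cancelling pair of syllables leaves an
element of `H` behind, so the induction must allow an arbitrary `c` between the words. The last
clause serves uniqueness: total cancellation forces inverse label lists. -/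
theorem exists_reduced_mul (w₁ : List (Σ i, G i)) :
    ∀ (c : H) (w₂ : List (Σ i, G i)), IsReduced φ w₁ → IsReduced φ w₂ →
      ∃ (c' : H) (w : List (Σ i, G i)), IsReduced φ w ∧
        wordProd φ w₁ * PushoutI.base φ c * wordProd φ w₂ =
          PushoutI.base φ c' * wordProd φ w ∧
        Cancels lab.flip (lab.labels w₁) (lab.labels w₂) (lab.labels w) ∧
        (w = [] → lab.labels w₂ = flipReverse lab.flip (lab.labels w₁)) := by
  induction w₁ using List.reverseRecOn with
  | nil =>
    intro c w₂ _ h₂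
    exact ⟨c, w₂, h₂, by simp, ⟨[], [], [], [], lab.labels w₂, [], by simp⟩, by
      rintro rfl; simp⟩
  | append_singleton w₁ p ih =>
    intro c w₂ h₁ h₂
    obtain ⟨i, p⟩ := p
    have hp : p ∉ (φ i).range := h₁.2 ⟨i, p⟩ (by simp)
    have hpc : p * φ i c ∉ (φ i).range := by
      rwa [Subgroup.mul_mem_cancel_right _ (MonoidHom.mem_range.2 ⟨c, rfl⟩)]
    have hw₁ : ∀ s ∈ w₁, s.2 ∉ (φ s.1).range := fun s hs => h₁.2 s (by simp [hs])
    have hof : PushoutI.of (φ := φ) i (p * φ i c) = PushoutI.of i p * PushoutI.base φ c := by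
      rw [map_mul, PushoutI.of_apply_eq_base]
    cases w₂ with
    | nil =>
      refine ⟨1, w₁ ++ [⟨i, p * φ i c⟩], ⟨by simpa using h₁.1, ?_⟩, ?_,
        ⟨lab.labels w₁ ++ lab.label ⟨i, p⟩, [], [], [], [], [], by simp [lab.mul_base]⟩, by simp⟩
      · intro s hs
        simp only [List.mem_append, List.mem_singleton] at hs
        rcases hs with hs | rfl
        exacts [hw₁ s hs, hpc]
      · simp [-map_mul, hof, mul_assoc]
    | cons q w₂ =>
      obtain ⟨j, q⟩ := q
      have hq : q ∉ (φ j).range := h₂.2 ⟨j, q⟩ (by simp)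
      have hw₂ : ∀ s ∈ w₂, s.2 ∉ (φ s.1).range := fun s hs => h₂.2 s (by simp [hs])
      by_cases hij : i = j
      · subst hij
        by_cases hr : p * φ i c * q ∈ (φ i).range
        · obtain ⟨d, hd⟩ := hr
          have h₁' : IsReduced φ w₁ := ⟨by
            have := h₁.1
            simp only [List.map_append] at this
            exact this.left_of_append, hw₁⟩
          have h₂' : IsReduced φ w₂ := ⟨by
            have := h₂.1
            simp only [List.map_cons] at this
            exact this.of_cons, hw₂⟩
          obtain ⟨c', w, hw, hprod, ⟨U, M₁, X, M₂, V, M, e₁, e₂, e₃, e₄, e₅, e₆⟩, hnil⟩ :=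
            ih d w₂ h₁' h₂'
          have hlab : lab.label ⟨i, q⟩ = flipReverse lab.flip (lab.label ⟨i, p⟩) := by
            -- Thus `q` lies in the double coset of `p⁻¹`, and its label is the flipped label of
            -- `p`.
            have : q = φ i c⁻¹ * (p⁻¹ * φ i d) := by
              rw [hd, map_inv]; group
            rw [flipReverse_label, ← lab.inv _ _ hp, this, lab.base_mul, lab.mul_base]
          refine ⟨c', w, hw, ?_, ⟨U, M₁, X ++ lab.label ⟨i, p⟩, M₂, V, M, e₁, e₂, e₃, ?_, ?_,
            e₆⟩, ?_⟩
          · rw [← hprod]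
            have : PushoutI.base φ d =
                PushoutI.of i p * PushoutI.base φ c * PushoutI.of i q := by
              rw [← PushoutI.of_apply_eq_base φ i d, hd, map_mul, hof]
            simp [this, mul_assoc]
          · simp [e₄]
          · simp [e₅, hlab]
          · intro h
            simp [hnil h, hlab]
        · refine ⟨1, w₁ ++ ⟨i, p * φ i c * q⟩ :: w₂, ⟨?_, ?_⟩, ?_,
            ⟨lab.labels w₁, lab.label ⟨i, p⟩, [], lab.label ⟨i, q⟩, lab.labels w₂,
              lab.label ⟨i, p * φ i c * q⟩, lab.length_le _, lab.length_le _, lab.length_le _,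
              by simp, by simp, by simp⟩, by simp⟩
          · simp only [List.map_append, List.map_cons]
            rw [List.isChain_split]
            exact ⟨by simpa using h₁.1, by simpa using h₂.1⟩
          · intro s hs
            simp only [List.mem_append, List.mem_cons] at hs
            rcases hs with hs | rfl | hs
            exacts [hw₁ s hs, hr, hw₂ s hs]
          · have : PushoutI.of (φ := φ) i (p * φ i c * q) =
                PushoutI.of i p * PushoutI.base φ c * PushoutI.of i q := by
              rw [map_mul, hof]
            simp [-map_mul, this]
            simp only [mul_assoc]
      · refine ⟨1, w₁ ++ ⟨i, p * φ i c⟩ :: ⟨j, q⟩ :: w₂, ⟨?_, ?_⟩, ?_,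
            ⟨lab.labels w₁ ++ lab.label ⟨i, p⟩, [], [], [], lab.label ⟨j, q⟩ ++ lab.labels w₂, [],
              by simp [lab.mul_base]⟩, by simp⟩
        · simp only [List.map_append, List.map_cons]
          rw [List.isChain_append_cons_cons]
          exact ⟨by simpa using h₁.1, hij, by simpa using h₂.1⟩
        · intro s hs
          simp only [List.mem_append, List.mem_cons] at hs
          rcases hs with hs | rfl | rfl | hs
          exacts [hw₁ s hs, hpc, hq, hw₂ s hs]
        · simp [-map_mul, hof, mul_assoc]

theorem exists_reduced (x : PushoutI φ) :
    ∃ (c : H) (w : List (Σ i, G i)), IsReduced φ w ∧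
      x = PushoutI.base φ c * wordProd φ w := by
  induction x using PushoutI.induction_on with
  | of i g =>
    by_cases hg : g ∈ (φ i).range
    · obtain ⟨c, rfl⟩ := hg
      exact ⟨c, [], ⟨by simp, by simp⟩, by simp [PushoutI.of_apply_eq_base]⟩
    · exact ⟨1, [⟨i, g⟩], ⟨by simp, by simpa using hg⟩, by simp⟩
  | base h => exact ⟨h, [], ⟨by simp, by simp⟩, by simp⟩
  | mul x y hx hy =>
    obtain ⟨c, w, hw, rfl⟩ := hx
    obtain ⟨d, w', hw', rfl⟩ := hy
    -- Only the reduced word is needed here, so any labelling will do.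
    let trivialLab : Labelling φ :=
      ⟨fun _ => [], id, by simp, by simp, by simp, by simp, by simp⟩
    obtain ⟨c', w'', hw'', h, -⟩ := trivialLab.exists_reduced_mul w d w' hw hw'
    exact ⟨c * c', w'', hw'', by simp only [map_mul, mul_assoc, ← h]⟩

/-- Multiplying one word by the inverse of the other gives an element of the base, whose reduced
word is empty by the normal form theorem; so everything cancels. -/
theorem labels_eq_of_mul_eq (hφ : ∀ i, Function.Injective (φ i)) {c c' : H}
    {w w' : List (Σ i, G i)} (hw : IsReduced φ w) (hw' : IsReduced φ w')
    (h : PushoutI.base φ c * wordProd φ w = PushoutI.base φ c' * wordProd φ w') :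
    lab.labels w = lab.labels w' := by
  obtain ⟨d, v, hv, hprod, -, hnil⟩ :=
    lab.exists_reduced_mul (wordInv w') (c'⁻¹ * c) w hw'.wordInv hw
  have h1 : PushoutI.base φ d * wordProd φ v = 1 := by
    rw [← hprod, wordProd_wordInv, map_mul, map_inv, mul_assoc, mul_assoc, h]
    group
  have : v = [] := hv.eq_nil hφ ⟨d⁻¹, by rw [map_inv]; exact inv_eq_of_mul_eq_one_right h1⟩
  rw [hnil this, lab.labels_wordInv hw'.2, flipReverse_flipReverse lab.flip_flip]

/-- The list of labels of an element of the amalgamated product. -/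
noncomputable def labelList (x : PushoutI φ) : List Bool :=
  lab.labels (exists_reduced x).choose_spec.choose

theorem labelList_eq (hφ : ∀ i, Function.Injective (φ i)) {c : H} {w : List (Σ i, G i)}
    (hw : IsReduced φ w) : lab.labelList (PushoutI.base φ c * wordProd φ w) = lab.labels w := by
  have h := (exists_reduced (PushoutI.base φ c * wordProd φ w)).choose_spec.choose_spec
  exact lab.labels_eq_of_mul_eq hφ h.1 hw h.2.symm

theorem cancels_labelList (hφ : ∀ i, Function.Injective (φ i)) (x y : PushoutI φ) :
    Cancels lab.flip (lab.labelList x) (lab.labelList y) (lab.labelList (x * y)) := by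
  obtain ⟨c, w, hw, rfl⟩ := exists_reduced x
  obtain ⟨d, w', hw', rfl⟩ := exists_reduced y
  obtain ⟨c', v, hv, hprod, hcan, -⟩ := lab.exists_reduced_mul w d w' hw hw'
  have : PushoutI.base φ c * wordProd φ w * (PushoutI.base φ d * wordProd φ w') =
      PushoutI.base φ (c * c') * wordProd φ v := by
    rw [map_mul, mul_assoc (PushoutI.base φ c) (PushoutI.base φ c'), ← hprod]
    simp only [mul_assoc]
  rwa [this, lab.labelList_eq hφ hw, lab.labelList_eq hφ hw', lab.labelList_eq hφ hv]

end Labelling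

end ReducedWords

/-! ### Quasi-additive functionals on binary lists -/

section Scan

/-- Read a binary list, keeping track of the number `b` of letters `false` read since the last
`true`, and of the length `a` of the gap before that. Whenever a gap of length `0` is followed by
a gap of length `b`, the value `f b` is added. -/
def scan (f : ℕ → ℝ) : ℕ → ℕ → List Bool → ℝ
  | _, _, [] => 0
  | a, b, false :: L => scan f a (b + 1) L
  | a, b, true :: L => (if a = 0 then f b else 0) + scan f b 0 L

@[simp] theorem scan_nil (f : ℕ → ℝ) (a b : ℕ) : scan f a b [] = 0 := rfl

@[simp] theorem scan_false (f : ℕ → ℝ) (a b : ℕ) (L : List Bool) :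
    scan f a b (false :: L) = scan f a (b + 1) L := rfl

@[simp] theorem scan_true (f : ℕ → ℝ) (a b : ℕ) (L : List Bool) :
    scan f a b (true :: L) = (if a = 0 then f b else 0) + scan f b 0 L := rfl

theorem scan_add (f g : ℕ → ℝ) (a b : ℕ) (L : List Bool) :
    scan (f + g) a b L = scan f a b L + scan g a b L := by
  induction L generalizing a b with
  | nil => simp
  | cons x L ih =>
    cases x
    · simp [ih]
    · simp only [scan_true, ih, Pi.add_apply]
      split_ifs <;> ring

theorem scan_smul (c : ℝ) (f : ℕ → ℝ) (a b : ℕ) (L : List Bool) :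
    scan (c • f) a b L = c * scan f a b L := by
  induction L generalizing a b with
  | nil => simp
  | cons x L ih =>
    cases x
    · simp [ih]
    · simp only [scan_true, ih, Pi.smul_apply, smul_eq_mul]
      split_ifs <;> ring

variable {f : ℕ → ℝ} {K : ℝ}

theorem abs_ite_le (hf : ∀ n, |f n| ≤ K) (a b : ℕ) : |if a = 0 then f b else 0| ≤ K := by
  split_ifs
  · exact hf b
  · simpa using (abs_nonneg _).trans (hf 0)

theorem abs_scan_sub_scan_le_of_count_eq (hf : ∀ n, |f n| ≤ K) (a a' b : ℕ) (L : List Bool) :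
    |scan f a b L - scan f a' b L| ≤ 2 * K := by
  have hK : 0 ≤ K := (abs_nonneg _).trans (hf 0)
  induction L generalizing b with
  | nil => simp [hK]
  | cons x L ih =>
    cases x
    · exact ih (b + 1)
    · have h1 := abs_le.1 (abs_ite_le hf a b)
      have h2 := abs_le.1 (abs_ite_le hf a' b)
      rw [scan_true, scan_true, abs_le]
      constructor <;> linarith

/-- The scanner forgets its initial state after two letters `true`, so only two contributions can
differ. -/
theorem abs_scan_sub_scan_le (hf : ∀ n, |f n| ≤ K) (a a' b b' : ℕ) (L : List Bool) :
    |scan f a b L - scan f a' b' L| ≤ 4 * K := by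
  have hK : 0 ≤ K := (abs_nonneg _).trans (hf 0)
  induction L generalizing b b' with
  | nil => simp [hK]
  | cons x L ih =>
    cases x
    · exact ih (b + 1) (b' + 1)
    · have h1 := abs_le.1 (abs_ite_le hf a b)
      have h2 := abs_le.1 (abs_ite_le hf a' b')
      have h3 := abs_le.1 (abs_scan_sub_scan_le_of_count_eq hf b b' 0 L)
      rw [scan_true, scan_true, abs_le]
      constructor <;> linarith

theorem abs_scan_append_le (hf : ∀ n, |f n| ≤ K) (a b a' b' : ℕ) (L L' : List Bool) :
    |scan f a b (L ++ L') - scan f a b L - scan f a' b' L'| ≤ 4 * K := by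
  induction L generalizing a b with
  | nil => simpa using abs_scan_sub_scan_le hf a a' b b' L'
  | cons x L ih =>
    cases x
    · exact ih a (b + 1)
    · simpa [add_sub_add_left_eq_sub] using ih b 0

theorem abs_scan_le_of_length_le (hf : ∀ n, |f n| ≤ K) (a b : ℕ) {L : List Bool}
    (hL : L.length ≤ 1) : |scan f a b L| ≤ K := by
  have hK : 0 ≤ K := (abs_nonneg _).trans (hf 0)
  match L, hL with
  | [], _ => simpa using hK
  | [false], _ => simpa using hK
  | [true], _ => simpa using abs_ite_le hf a b

/-- The antisymmetrization of `scan` with respect to `flipReverse`. -/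
def antiScan (flip : Bool → Bool) (f : ℕ → ℝ) (L : List Bool) : ℝ :=
  scan f 1 0 L - scan f 1 0 (flipReverse flip L)

variable {flip : Bool → Bool}

theorem antiScan_flipReverse (h : ∀ b, flip (flip b) = b) (L : List Bool) :
    antiScan flip f (flipReverse flip L) = -antiScan flip f L := by
  simp [antiScan, flipReverse_flipReverse h]

theorem abs_antiScan_append_le (hf : ∀ n, |f n| ≤ K) (L L' : List Bool) :
    |antiScan flip f (L ++ L') - antiScan flip f L - antiScan flip f L'| ≤ 8 * K := by
  have h1 := abs_le.1 (abs_scan_append_le hf 1 0 1 0 L L')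
  have h2 := abs_le.1 (abs_scan_append_le hf 1 0 1 0 (flipReverse flip L') (flipReverse flip L))
  rw [antiScan, antiScan, antiScan, flipReverse_append, abs_le]
  constructor <;> linarith

theorem abs_antiScan_le_of_length_le (hf : ∀ n, |f n| ≤ K) {L : List Bool}
    (hL : L.length ≤ 1) : |antiScan flip f L| ≤ 2 * K := by
  have h1 := abs_le.1 (abs_scan_le_of_length_le hf 1 0 hL)
  have h2 := abs_le.1 (abs_scan_le_of_length_le hf 1 0
    (L := flipReverse flip L) (by simpa [flipReverse] using hL))
  rw [antiScan, abs_le]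
  constructor <;> linarith

theorem abs_antiScan_append_append_le (hf : ∀ n, |f n| ≤ K) (L : List Bool) {M : List Bool}
    (L' : List Bool) (hM : M.length ≤ 1) :
    |antiScan flip f (L ++ M ++ L') - antiScan flip f L - antiScan flip f L'| ≤ 18 * K := by
  have h1 := abs_le.1 (abs_antiScan_append_le (flip := flip) hf (L ++ M) L')
  have h2 := abs_le.1 (abs_antiScan_append_le (flip := flip) hf L M)
  have h3 := abs_le.1 (abs_antiScan_le_of_length_le (flip := flip) hf hM)
  rw [abs_le]
  constructor <;> linarith

/-- The contributions of `U` and `V` cancel by approximate additivity and those of `X` by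
antisymmetry. Each of the three decompositions costs `18 * K`. -/
theorem Cancels.abs_antiScan_le (hf : ∀ n, |f n| ≤ K) (h : ∀ b, flip (flip b) = b)
    {L₁ L₂ L₃ : List Bool} (hL : Cancels flip L₁ L₂ L₃) :
    |antiScan flip f L₂ - antiScan flip f L₃ + antiScan flip f L₁| ≤ 54 * K := by
  obtain ⟨U, M₁, X, M₂, V, M, hM₁, hM₂, hM, rfl, rfl, rfl⟩ := hL
  have h1 := abs_le.1 (abs_antiScan_append_append_le (flip := flip) hf U X hM₁)
  have h2 := abs_le.1 (abs_antiScan_append_append_le (flip := flip) hf (flipReverse flip X) V hM₂)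
  have h3 := abs_le.1 (abs_antiScan_append_append_le (flip := flip) hf U V hM)
  rw [antiScan_flipReverse h] at h2
  rw [abs_le]
  constructor <;> linarith

theorem scan_replicate_false (a b n : ℕ) (L : List Bool) :
    scan f a b (List.replicate n false ++ L) = scan f a (b + n) L := by
  induction n generalizing b with
  | zero => simp
  | succ n ih => simp [List.replicate_succ, ih, add_assoc, add_comm 1]

theorem scan_replicate_true (h0 : f 0 = 0) (n : ℕ) (L : List Bool) :
    scan f 0 0 (List.replicate n true ++ L) = scan f 0 0 L := by
  induction n with
  | zero => simp
  | succ n ih => simp [List.replicate_succ, ih, h0]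

/-- A binary list with cyclic sequence of gaps `0, n, 1`. -/
def gapWord (n : ℕ) : List Bool := true :: (List.replicate n false ++ [true, false, true])

/-- The powers of `gapWord`. -/
def gapWordPow (n k : ℕ) : List Bool := (List.replicate k (gapWord n)).flatten

/-- Each block begins in state `(1, 0)` and returns to it, contributing `f n` once, for the gap `n`
after the gap `0`. In the reversed list the gap `0` is followed by `1` instead. -/
theorem scan_gapWordPow (h1 : f 1 = 0) (n k : ℕ) :
    scan f 1 0 (gapWordPow n k) = k * f n := by
  induction k with
  | zero => simp [gapWordPow]
  | succ k ih =>
    rw [gapWordPow] at ih ⊢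
    simp [List.replicate_succ, gapWord, scan_replicate_false, h1] at ih ⊢
    rw [ih]
    ring

theorem scan_reverse_gapWordPow (h0 : f 0 = 0) (h1 : f 1 = 0) (n k a : ℕ) :
    scan f a 0 (gapWordPow n k).reverse = 0 := by
  have : (gapWordPow n k).reverse =
      (List.replicate k ([true, false, true] ++ (List.replicate n false ++ [true]))).flatten := by
    simp [gapWordPow, gapWord, List.reverse_flatten]
  rw [this]
  clear this
  induction k generalizing a with
  | zero => simp
  | succ k ih =>
    simp only [List.replicate_succ, List.flatten_cons, List.append_assoc, List.cons_append,
      List.nil_append, scan_true, scan_false, scan_replicate_false]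
    simpa [h0, h1] using ih _

theorem scan_map_not_gapWordPow (h0 : f 0 = 0) (h1 : f 1 = 0) (n k b : ℕ) :
    scan f 1 b ((gapWordPow (n + 2) k).map not) = 0 := by
  have : (gapWordPow (n + 2) k).map not = (List.replicate k
      (false :: true :: true :: (List.replicate n true ++ [false, true, false]))).flatten := by
    simp [gapWordPow, gapWord, List.map_flatten, List.replicate_succ]
  rw [this]
  clear this
  induction k generalizing b with
  | zero => simp
  | succ k ih =>
    simp only [List.replicate_succ, List.flatten_cons, List.append_assoc, List.cons_append,
      List.nil_append, scan_true, scan_false, scan_replicate_true h0]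
    simpa [h0, h1] using ih _

theorem scan_map_not_reverse_gapWordPow (h0 : f 0 = 0) (h2 : f 2 = 0) (n k : ℕ) :
    scan f 1 0 ((gapWordPow (n + 2) k).map not).reverse = 0 := by
  have : ((gapWordPow (n + 2) k).map not).reverse = (List.replicate k
      (false :: true :: false :: true :: true :: (List.replicate n true ++ [false]))).flatten := by
    simp [gapWordPow, gapWord, List.map_flatten, List.reverse_flatten, List.replicate_succ,
      ← List.replicate_succ']
  rw [this]
  clear this
  -- These are the states at the start of the first block and of later ones. Across a block boundary
  -- a gap `0` is followed by a gap `2`, which is why `f 2 = 0` is required.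
  have key : ∀ a b, (a = 1 ∧ b = 0) ∨ (a = 0 ∧ b = 1) →
      scan f a b (List.replicate k (false :: true :: false :: true :: true ::
        (List.replicate n true ++ [false]))).flatten = 0 := by
    induction k with
    | zero => simp
    | succ k ih =>
      rintro a b (⟨rfl, rfl⟩ | ⟨rfl, rfl⟩) <;>
      · simp only [List.replicate_succ, List.flatten_cons, List.append_assoc, List.cons_append,
          List.nil_append, scan_true, scan_false, scan_replicate_true h0]
        simpa [h0, h2] using ih _ _ (.inr ⟨rfl, rfl⟩)
  exact key 1 0 (.inl ⟨rfl, rfl⟩)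

theorem mul_abs_le_abs_antiScan_gapWordPow (h0 : f 0 = 0) (h1 : f 1 = 0) (h2 : f 2 = 0)
    (hflip : flip = id ∨ flip = not) (n k : ℕ) :
    k * |f (n + 2)| ≤ |antiScan flip f (gapWordPow (n + 2) k) -
      antiScan flip f (gapWordPow (n + 2) k).reverse| := by
  have e1 := scan_gapWordPow h1 (n + 2) k
  have e2 := scan_reverse_gapWordPow h0 h1 (n + 2) k 1
  have e3 := scan_map_not_gapWordPow h0 h1 n k 0
  have e4 := scan_map_not_reverse_gapWordPow h0 h2 n k
  have hnn : 0 ≤ k * |f (n + 2)| := by positivity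
  have habs : k * |f (n + 2)| = |k * f (n + 2)| := by rw [abs_mul, Nat.abs_cast]
  rcases hflip with rfl | rfl
  · simp only [antiScan, flipReverse, List.map_id, List.reverse_reverse, e1, e2]
    rw [sub_zero, zero_sub, sub_neg_eq_add, ← two_mul, abs_mul, ← habs, abs_two]
    linarith
  · simp only [antiScan, flipReverse, List.map_reverse, List.reverse_reverse, e1, e2, e3, e4,
      sub_zero]
    exact habs.le

end Scan

/-! ### Quasimorphisms from labellings -/

section Quasimorphism

variable {G : Bool → Type*} {H : Type*} [∀ i, Group (G i)] [Group H] {φ : ∀ i, H →* G i}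

/-- The list of syllables obtained by interleaving the letters `a x`, for `x` in a binary list,
with the fixed letter `b`. -/
def interleave (a : Bool → G false) (b : G true) (L : List Bool) : List (Σ i, G i) :=
  L.flatMap fun x => [⟨false, a x⟩, ⟨true, b⟩]

theorem isReduced_interleave {a : Bool → G false} {b : G true}
    (ha : ∀ x, a x ∉ (φ false).range) (hb : b ∉ (φ true).range) (L : List Bool) :
    IsReduced φ (interleave a b L) := by
  refine ⟨?_, ?_⟩
  · induction L with
    | nil => simp [interleave]
    | cons x L ih =>
      cases L with
      | nil => simp [interleave]
      | cons y L => simpa [interleave] using ih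
  · intro s hs
    simp only [interleave, List.mem_flatMap] at hs
    obtain ⟨x, -, hs⟩ := hs
    simp only [List.mem_cons, List.not_mem_nil, or_false] at hs
    rcases hs with rfl | rfl
    exacts [ha x, hb]

theorem wordProd_interleave (a : Bool → G false) (b : G true) (L : List Bool) :
    wordProd φ (interleave a b L) =
      (L.map fun x => PushoutI.of false (a x) * PushoutI.of true b).prod := by
  induction L with
  | nil => simp [interleave]
  | cons x L ih =>
    have : interleave a b (x :: L) = ⟨false, a x⟩ :: ⟨true, b⟩ :: interleave a b L := by
      simp [interleave]
    simp [this, ih, mul_assoc]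

theorem Labelling.labels_interleave (lab : Labelling φ) {a : Bool → G false} {b : G true}
    (ha : ∀ x, lab.label ⟨false, a x⟩ = [x]) (hb : lab.label ⟨true, b⟩ = []) (L : List Bool) :
    lab.labels (interleave a b L) = L := by
  induction L with
  | nil => simp [interleave]
  | cons x L ih =>
    have : interleave a b (x :: L) = ⟨false, a x⟩ :: ⟨true, b⟩ :: interleave a b L := by
      simp [interleave]
    simp [this, ih, ha, hb]

theorem Labelling.eq_zero_of_abs_sub_le (hφ : ∀ i, Function.Injective (φ i)) (lab : Labelling φ)
    (hflip : lab.flip = id ∨ lab.flip = not) {a : Bool → G false} {b : G true}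
    (ha : ∀ x, a x ∉ (φ false).range) (hb : b ∉ (φ true).range)
    (hla : ∀ x, lab.label ⟨false, a x⟩ = [x]) (hlb : lab.label ⟨true, b⟩ = [])
    {f : ℕ → ℝ} (h0 : f 0 = 0) (h1 : f 1 = 0) (h2 : f 2 = 0)
    (ψ : PushoutI φ →* Multiplicative ℝ) {K : ℝ}
    (hψ : ∀ x, |antiScan lab.flip f (lab.labelList x) - (ψ x).toAdd| ≤ K) (n : ℕ) :
    f (n + 2) = 0 := by
  have hlist : ∀ L, lab.labelList (wordProd φ (interleave a b L)) = L := fun L => by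
    have := lab.labelList_eq hφ (c := 1) (isReduced_interleave ha hb L)
    rwa [map_one, one_mul, lab.labels_interleave hla hlb] at this
  -- The target is commutative, so only the multiset of factors matters.
  have hrev : ∀ L, ψ (wordProd φ (interleave a b L.reverse)) =
      ψ (wordProd φ (interleave a b L)) := fun L => by
    rw [wordProd_interleave, wordProd_interleave, map_list_prod, map_list_prod]
    exact (((List.reverse_perm L).map _).map _).prod_eq
  have hbound : ∀ k : ℕ, k * |f (n + 2)| ≤ 2 * K := fun k => by
    refine (mul_abs_le_abs_antiScan_gapWordPow h0 h1 h2 hflip n k).trans ?_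
    have e1 := hψ (wordProd φ (interleave a b (gapWordPow (n + 2) k)))
    have e2 := hψ (wordProd φ (interleave a b (gapWordPow (n + 2) k).reverse))
    rw [hrev] at e2
    rw [hlist] at e1 e2
    rw [abs_le] at *
    constructor <;> linarith
  by_contra hne
  obtain ⟨k, hk⟩ := exists_nat_gt (2 * K / |f (n + 2)|)
  rw [div_lt_iff₀ (abs_pos.2 hne)] at hk
  exact absurd (hbound k) (not_le.2 hk)

end Quasimorphism

/-! ### Low-degree coboundaries, and dimension counts -/

section Cohomology

variable {Γ : Type*} [Group Γ]

theorem coboundary_one_apply (h : Γ → ℝ) (x : Fin 2 → Γ) :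
    coboundary Γ 1 (fun y => h (y 0)) x = h (x 1) - h (x 0 * x 1) + h (x 0) := by
  simp [coboundary, Fin.sum_univ_two, Fin.contractNth]
  ring

theorem coboundary_coboundary_one (h : Γ → ℝ) :
    coboundary Γ 2 (coboundary Γ 1 (fun y => h (y 0))) = 0 := by
  have : coboundary Γ 1 (fun y => h (y 0)) =
      fun x => h (x 1) - h (x 0 * x 1) + h (x 0) := funext (coboundary_one_apply h)
  rw [this]
  ext x
  simp [coboundary, Fin.sum_univ_three, Fin.contractNth, mul_assoc]
  ring

theorem rank_boundedCohomology_le_continuum [Countable Γ] (k : ℕ) :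
    Module.rank ℝ (BoundedCohomology Γ k) ≤ Cardinal.continuum := by
  refine (rank_le_card ℝ _).trans ((Cardinal.mk_le_of_surjective
    (Submodule.mkQ_surjective _)).trans ((Cardinal.mk_subtype_le _).trans ?_))
  rw [Cardinal.mk_arrow, Cardinal.mk_real, Cardinal.lift_continuum]
  refine (Cardinal.power_le_power_left Cardinal.continuum_ne_zero ?_).trans
    Cardinal.continuum_power_aleph0.le
  rw [Cardinal.lift_uzero]
  exact Cardinal.mk_le_aleph0

/-- The bounded real sequences. -/
def boundedSeq : Submodule ℝ (ℕ → ℝ) where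
  carrier := {f | ∃ K : ℝ, ∀ n, |f n| ≤ K}
  zero_mem' := ⟨0, fun x => by simp⟩
  add_mem' := by
    rintro f g ⟨K, hK⟩ ⟨L, hL⟩
    exact ⟨K + L, fun x => (abs_add_le _ _).trans (add_le_add (hK x) (hL x))⟩
  smul_mem' := by
    rintro c f ⟨K, hK⟩
    refine ⟨|c| * K, fun x => ?_⟩
    rw [Pi.smul_apply, smul_eq_mul, abs_mul]
    exact mul_le_mul_of_nonneg_left (hK x) (abs_nonneg c)

/-- The sequences `t ^ n` with `0 < t < 1` are distinct characters of the monoid `ℕ`, hence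
independent by Dedekind. -/
theorem continuum_le_rank_boundedSeq : Cardinal.continuum ≤ Module.rank ℝ boundedSeq := by
  let geom : Set.Ioo (0 : ℝ) 1 → boundedSeq := fun t => ⟨fun n => t.1 ^ n, 1, fun n => by
    rw [abs_pow, abs_of_pos t.2.1]
    exact pow_le_one₀ t.2.1.le t.2.2.le⟩
  have hgeom : LinearIndependent ℝ geom := by
    apply LinearIndependent.of_comp boundedSeq.subtype
    have h := linearIndependent_monoidHom (Multiplicative ℕ) ℝ
    exact h.comp (fun t : Set.Ioo (0 : ℝ) 1 => powersHom ℝ t.1) fun s t hst => by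
      simpa using Subtype.ext ((powersHom ℝ).injective hst)
  have := hgeom.cardinal_le_rank
  rwa [Cardinal.mk_Ioo_real one_pos] at this

/-- The sequence delayed by three steps, starting with zeros. -/
def delay : (ℕ → ℝ) →ₗ[ℝ] (ℕ → ℝ) where
  toFun f n := if n < 3 then 0 else f (n - 3)
  map_add' f g := by
    ext n
    by_cases h : n < 3 <;> simp [h]
  map_smul' c f := by
    ext n
    by_cases h : n < 3 <;> simp [h]

end Cohomology

/-! ### Embedding bounded sequences into second bounded cohomology -/

section LowerBound

variable {G : Bool → Type*} {H : Type*} [∀ i, Group (G i)] [Group H] {φ : ∀ i, H →* G i}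

namespace Labelling

variable (lab : Labelling φ)

/-- The 1-cochain of the quasimorphism counting gaps with weights given by a sequence. -/
noncomputable def gapCochain : (ℕ → ℝ) →ₗ[ℝ] ((Fin 1 → PushoutI φ) → ℝ) where
  toFun f x := antiScan lab.flip (delay f) (lab.labelList (x 0))
  map_add' f g := by
    ext x
    simp only [map_add, antiScan, scan_add, Pi.add_apply]
    ring
  map_smul' c f := by
    ext x
    simp only [map_smul, antiScan, scan_smul, Pi.smul_apply, smul_eq_mul, RingHom.id_apply]
    ring

theorem coboundary_gapCochain_mem (hφ : ∀ i, Function.Injective (φ i)) (f : ℕ → ℝ)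
    (hf : f ∈ boundedSeq) :
    (coboundary _ 1 ∘ₗ lab.gapCochain) f ∈ boundedCocycles (PushoutI φ) 2 := by
  obtain ⟨K, hK⟩ := hf
  have hd : ∀ n, |delay f n| ≤ K := fun n => by
    by_cases h : n < 3
    · simpa [delay, h] using (abs_nonneg _).trans (hK 0)
    · simpa [delay, h] using hK _
  refine ⟨⟨54 * K, fun x => ?_⟩, coboundary_coboundary_one
    fun x => antiScan lab.flip (delay f) (lab.labelList x)⟩
  have := coboundary_one_apply (fun x => antiScan lab.flip (delay f) (lab.labelList x)) x
  refine (congrArg abs this).le.trans ?_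
  exact (lab.cancels_labelList hφ (x 0) (x 1)).abs_antiScan_le hd lab.flip_flip

theorem continuum_le_rank (hφ : ∀ i, Function.Injective (φ i))
    (hflip : lab.flip = id ∨ lab.flip = not) {a : Bool → G false} {b : G true}
    (ha : ∀ x, a x ∉ (φ false).range) (hb : b ∉ (φ true).range)
    (hla : ∀ x, lab.label ⟨false, a x⟩ = [x]) (hlb : lab.label ⟨true, b⟩ = []) :
    Cardinal.continuum ≤ Module.rank ℝ (BoundedCohomology (PushoutI φ) 2) := by
  let T : boundedSeq →ₗ[ℝ] BoundedCohomology (PushoutI φ) 2 := Submodule.mkQ _ ∘ₗ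
    (coboundary _ 1 ∘ₗ lab.gapCochain).restrict (lab.coboundary_gapCochain_mem hφ)
  have hT : Function.Injective T := by
    rw [injective_iff_map_eq_zero]
    rintro ⟨f, hf⟩ h
    have h' : (coboundary _ 1 (lab.gapCochain f)) ∈ boundedCoboundaries (PushoutI φ) 2 :=
      by
      have h := (Submodule.Quotient.mk_eq_zero _).1 (show Submodule.Quotient.mk _ = _ from h)
      exact h
    obtain ⟨β, ⟨K, hK⟩, hβ⟩ := h'
    set q : PushoutI φ → ℝ := fun x => antiScan lab.flip (delay f) (lab.labelList x) with hq
    have hβ' : ∀ x y, q y - q (x * y) + q x =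
        β (fun _ => y) - β (fun _ => x * y) + β (fun _ => x) := fun x y => by
      have e1 := coboundary_one_apply q ![x, y]
      have e2 := coboundary_one_apply (fun z => β fun _ => z) ![x, y]
      have e3 : (fun z : Fin 1 → PushoutI φ => β fun _ => z 0) = β := by
        ext z
        congr 1
        ext i
        rw [Subsingleton.elim i 0]
      rw [e3] at e2
      have := congrFun hβ ![x, y]
      rw [e2] at this
      exact e1.symm.trans this.symm
    let ψ : PushoutI φ →* Multiplicative ℝ := MonoidHom.mk'
      (fun x => Multiplicative.ofAdd (q x - β fun _ => x)) fun x y => by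
        rw [← ofAdd_add]
        congr 1
        linarith [hβ' x y]
    have hzero := lab.eq_zero_of_abs_sub_le hφ hflip ha hb hla hlb (f := delay f) (by simp [delay])
      (by simp [delay]) (by simp [delay]) ψ (K := K) fun x => by
        simpa [ψ, hq] using hK fun _ => x
    ext n
    -- The delay makes the weights at `0, 1, 2` vanish; index `(n + 1) + 2` of the delayed sequence
    -- is index `n` of `f`.
    simpa [delay] using hzero (n + 1)
  have := T.lift_rank_le_of_injective hT
  rw [Cardinal.lift_id'] at this
  refine le_trans ?_ this
  simpa using continuum_le_rank_boundedSeq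

end Labelling

end LowerBound

/-! ### Two-colouring the double cosets -/

section Labels

variable {A B : Type u} {C : Type v} [Group A] [Group B] [Group C] {f : C →* A} {g : C →* B}

/-- The labelling of the amalgamated product of two groups given by a function on the first
factor. -/
def labellingOfFun (f : C →* A) (g : C →* B) (l : A → Bool) (flip : Bool → Bool)
    (flip_flip : ∀ b, flip (flip b) = b) (base_mul : ∀ c x, l (f c * x) = l x)
    (mul_base : ∀ c x, l (x * f c) = l x) (inv : ∀ x, x ∉ f.range → l x⁻¹ = flip (l x)) :
    Labelling (factorMap f g) where
  label
    | ⟨false, x⟩ => [l x]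
    | ⟨true, _⟩ => []
  flip := flip
  flip_flip := flip_flip
  length_le := by rintro ⟨_ | _, x⟩ <;> simp
  base_mul := by
    rintro (_ | _) c x
    · exact congrArg (fun b => [b]) (base_mul c x)
    · rfl
  mul_base := by
    rintro (_ | _) c x
    · exact congrArg (fun b => [b]) (mul_base c x)
    · rfl
  inv := by
    rintro (_ | _) x hx
    · exact congrArg (fun b => [b]) (inv x hx)
    · rfl

/-- If a subgroup `S` has at least three double cosets then the nontrivial ones can be labelled
with two labels in such a way that inversion either preserves or swaps the labels. -/
theorem exists_doubleCoset_label (S : Subgroup A)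
    (hS : 3 ≤ Cardinal.mk (DoubleCoset.Quotient (S : Set A) (S : Set A))) :
    ∃ (l : A → Bool) (flip : Bool → Bool), (flip = id ∨ flip = not) ∧
      (∀ c ∈ S, ∀ x, l (c * x) = l x) ∧ (∀ c ∈ S, ∀ x, l (x * c) = l x) ∧
      (∀ x, x ∉ S → l x⁻¹ = flip (l x)) ∧ ∀ b, ∃ x, x ∉ S ∧ l x = b := by
  classical
  let D : A → DoubleCoset.Quotient (S : Set A) S := DoubleCoset.mk S S
  have hD : ∀ x y, D x = D y ↔ ∃ h ∈ S, ∃ k ∈ S, y = h * x * k := DoubleCoset.eq S S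
  have hleft : ∀ c ∈ S, ∀ x, D (c * x) = D x := fun c hc x =>
    (hD _ _).2 ⟨c⁻¹, inv_mem hc, 1, one_mem _, by simp⟩
  have hright : ∀ c ∈ S, ∀ x, D (x * c) = D x := fun c hc x =>
    (hD _ _).2 ⟨1, one_mem _, c⁻¹, inv_mem hc, by simp⟩
  have hinv : ∀ x y, D x = D y → D x⁻¹ = D y⁻¹ := fun x y h => by
    obtain ⟨s, hs, t, ht, rfl⟩ := (hD _ _).1 h
    exact (hD _ _).2 ⟨t⁻¹, inv_mem ht, s⁻¹, inv_mem hs, by simp [mul_assoc]⟩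
  have hinv' : ∀ x y, D x⁻¹ = D y ↔ D x = D y⁻¹ := fun x y =>
    ⟨fun h => by simpa using hinv _ _ h, fun h => by simpa using hinv _ _ h⟩
  have hone : ∀ x, D x ≠ D 1 → x ∉ S := fun x hx hxS =>
    hx (by simpa using hleft x hxS 1)
  obtain ⟨q, hq, -⟩ := Cardinal.exists_ne_ne_of_three_le hS (D 1) (D 1)
  obtain ⟨r, hr, hrq⟩ := Cardinal.exists_ne_ne_of_three_le hS (D 1) q
  obtain ⟨a, rfl⟩ : ∃ a, D a = q := Quotient.exists_rep q
  obtain ⟨b, rfl⟩ : ∃ b, D b = r := Quotient.exists_rep r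
  -- If some nontrivial double coset is neither that of `a` nor that of `a⁻¹`, colour by membership
  -- in this inverse-closed pair. Otherwise these two are the only nontrivial ones, they are
  -- distinct, and inversion swaps them.
  by_cases h : ∃ x, x ∉ S ∧ ¬ (D x = D a ∨ D x⁻¹ = D a)
  · obtain ⟨x, hxS, hx⟩ := h
    refine ⟨fun x => decide (D x = D a ∨ D x⁻¹ = D a), id, .inl rfl, fun c hc x => ?_,
      fun c hc x => ?_, fun x _ => ?_, Bool.forall_bool.2 ⟨⟨x, hxS, decide_eq_false hx⟩,
        ⟨a, hone a hq, by simp⟩⟩⟩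
    · simp only [mul_inv_rev, hleft c hc, hright _ (inv_mem hc)]
    · simp only [mul_inv_rev, hright c hc, hleft _ (inv_mem hc)]
    · simp [or_comm]
  · push Not at h
    refine ⟨fun x => decide (D x = D a), not, .inr rfl, fun c hc x => ?_,
      fun c hc x => ?_, fun x hx => ?_, Bool.forall_bool.2 ⟨⟨b, hone b hr, by simpa using hrq⟩,
        ⟨a, hone a hq, by simp⟩⟩⟩
    · simp only [hleft c hc]
    · simp only [hright c hc]
    · have hba : D b = D a⁻¹ := (hinv' _ _).1 ((h b (hone b hr)).resolve_left hrq)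
      have haa : D a⁻¹ ≠ D a := fun e => hrq (hba.trans e)
      by_cases hxa : D x = D a
      · have : D x⁻¹ ≠ D a := by rwa [hinv _ _ hxa]
        simp [hxa, this]
      · simp [hxa, (h x hx).resolve_left hxa]

end Labels

end AmalgHb

theorem theorem1 {A B : Type u} {C : Type v} [Group A] [Group B] [Group C]
    (f : C →* A) (g : C →* B) (hf : Function.Injective f) (hg : Function.Injective g)
    (hA : 3 ≤ Cardinal.mk (DoubleCoset.Quotient (f.range : Set A) (f.range : Set A)))
    (hB : 2 ≤ Cardinal.mk (B ⧸ g.range)) :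
    Cardinal.continuum ≤
        Module.rank ℝ (AmalgHb.BoundedCohomology (AmalgHb.AmalgamatedProduct f g) 2) ∧
      (Countable (AmalgHb.AmalgamatedProduct f g) →
        Module.rank ℝ (AmalgHb.BoundedCohomology (AmalgHb.AmalgamatedProduct f g) 2) =
          Cardinal.continuum) := by
  have hlower : Cardinal.continuum ≤
      Module.rank ℝ (AmalgHb.BoundedCohomology (AmalgHb.AmalgamatedProduct f g) 2) := by
    obtain ⟨l, flip, hflip, hl, hr, hinv, hsurj⟩ := AmalgHb.exists_doubleCoset_label f.range hA
    choose a ha hla using hsurj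
    obtain ⟨q, hq⟩ := (Cardinal.two_le_iff' (QuotientGroup.mk (1 : B) : B ⧸ g.range)).1 hB
    obtain ⟨b, rfl⟩ := QuotientGroup.mk_surjective q
    have hb : b ∉ g.range := fun h => hq (QuotientGroup.eq.2 (by simpa using h))
    have hinj : ∀ i, Function.Injective (AmalgHb.factorMap f g i) :=
      Bool.forall_bool.2 ⟨hf, hg⟩
    have hff : ∀ x, flip (flip x) = x := by
      rcases hflip with rfl | rfl <;> simp
    exact (AmalgHb.labellingOfFun f g l flip hff (fun c => hl _ ⟨c, rfl⟩)
      (fun c => hr _ ⟨c, rfl⟩) hinv).continuum_le_rank hinj hflip (a := a) (b := b) ha hb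
      (fun x => congrArg (fun y => [y]) (hla x)) rfl
  exact ⟨hlower, fun _ => le_antisymm (AmalgHb.rank_boundedCohomology_le_continuum 2) hlower⟩
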